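/- Let $p\in\mathbb{R}[x,y]$ be one of the following polynomials: 1. $p(x,y)=y+xy^2+y^4$; 2. $p(x,y)=y+a\,y^2+xy^3$, with $a=0$ or $a=1$; 3. $p(x,y)=y+x^2y^2$; 4. $p(x,y)=y+a\,y^2+y^3+x^2y^2$, with $a\in\mathbb{R}$ and $a^2-3<0$. Then there is no polynomial $q\in\mathbb{R}[x,y]$ such that $\det D(p,q)(x,y)>0$ for all $(x,y)\in\mathbb{R}^2$, where $\det D(p,q)$ denotes the Jacobian determinant of the polynomial map $(p,q):\mathbb{R}^2\to\mathbb{R}^2$. -/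

import Mathlib

open MvPolynomial

noncomputable section

/-- The value `p(x, y)` of a real polynomial in two variables, as a function on the plane;
the variable `X 0` stands for `x` and `X 1` for `y`. -/
def evalPlane (p : MvPolynomial (Fin 2) ℝ) (v : ℝ × ℝ) : ℝ :=
  MvPolynomial.eval ![v.1, v.2] p

/-- The polynomial map `(p, q) : ℝ² → ℝ²`. -/
def planeMap (p q : MvPolynomial (Fin 2) ℝ) (v : ℝ × ℝ) : ℝ × ℝ :=
  (evalPlane p v, evalPlane q v)

/-- The Jacobian determinant `det D(p, q)` at a point: the determinant of the derivative of the
polynomial map `(p, q)`. -/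
def jacobianDet (p q : MvPolynomial (Fin 2) ℝ) (v : ℝ × ℝ) : ℝ :=
  (fderiv ℝ (planeMap p q) v).det

/-- The four normal forms of real quartic polynomial submersions of the plane having a
disconnected level set. -/
inductive IsQuarticNormalForm : MvPolynomial (Fin 2) ℝ → Prop
  /-- `y + x y² + y⁴` -/
  | case1 : IsQuarticNormalForm (X 1 + X 0 * X 1 ^ 2 + X 1 ^ 4)
  /-- `y + a y² + x y³`, with `a = 0` or `a = 1` -/
  | case2 (a : ℝ) (ha : a = 0 ∨ a = 1) :
      IsQuarticNormalForm (X 1 + C a * X 1 ^ 2 + X 0 * X 1 ^ 3)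
  /-- `y + x² y²` -/
  | case3 : IsQuarticNormalForm (X 1 + X 0 ^ 2 * X 1 ^ 2)
  /-- `y + a y² + y³ + x² y²`, with `a² - 3 < 0` -/
  | case4 (a : ℝ) (ha : a ^ 2 - 3 < 0) :
      IsQuarticNormalForm (X 1 + C a * X 1 ^ 2 + X 1 ^ 3 + X 0 ^ 2 * X 1 ^ 2)

end

open Set Filter Topology

/-! On the line `y = 0` every normal form vanishes with gradient `(0, 1)`, so a positive Jacobian
makes `x ↦ q(x, 0)` a strictly decreasing polynomial, unbounded at both ends
(`Polynomial.not_bddBelow_of_derivative_neg`). But the level curve of `p` through `(x, s)`, with `s`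
small of suitable sign, reaches `y = -1` or `y = 1` as a graph over `y`, and `q` is monotone along
it (`evalPlane_lt_of_level_curve`). As `s → 0` its endpoint tends to a point independent of `x`,
which bounds `q(x, 0)` on one side: a contradiction. -/

theorem differentiable_evalPlane (p : MvPolynomial (Fin 2) ℝ) :
    Differentiable ℝ (evalPlane p) := by
  unfold evalPlane
  induction p using MvPolynomial.induction_on with
  | C a => simp
  | add p q hp hq => simp only [map_add]; exact hp.add hq
  | mul_X p i hp =>
    simp only [map_mul, MvPolynomial.eval_X]
    refine hp.mul ?_
    fin_cases i
    · exact differentiable_fst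
    · exact differentiable_snd

theorem continuous_evalPlane (p : MvPolynomial (Fin 2) ℝ) : Continuous (evalPlane p) :=
  (differentiable_evalPlane p).continuous

theorem det_prod_continuousLinearMap (A B : ℝ × ℝ →L[ℝ] ℝ) :
    (A.prod B).det = A (1, 0) * B (0, 1) - A (0, 1) * B (1, 0) := by
  rw [ContinuousLinearMap.det, ← LinearMap.det_toMatrix (Module.Basis.finTwoProd ℝ),
    Matrix.det_fin_two]
  simp [LinearMap.toMatrix_apply]

theorem jacobianDet_eq (p q : MvPolynomial (Fin 2) ℝ) (v : ℝ × ℝ) :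
    jacobianDet p q v =
      fderiv ℝ (evalPlane p) v (1, 0) * fderiv ℝ (evalPlane q) v (0, 1) -
        fderiv ℝ (evalPlane p) v (0, 1) * fderiv ℝ (evalPlane q) v (1, 0) := by
  have h : HasFDerivAt (planeMap p q)
      ((fderiv ℝ (evalPlane p) v).prod (fderiv ℝ (evalPlane q) v)) v :=
    (differentiable_evalPlane p v).hasFDerivAt.prodMk (differentiable_evalPlane q v).hasFDerivAt
  rw [jacobianDet, h.fderiv, det_prod_continuousLinearMap]

theorem hasDerivAt_evalPlane_graph (p : MvPolynomial (Fin 2) ℝ) {γ : ℝ → ℝ} {γ' y : ℝ}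
    (h : HasDerivAt γ γ' y) :
    HasDerivAt (fun t => evalPlane p (γ t, t))
      (γ' * fderiv ℝ (evalPlane p) (γ y, y) (1, 0) + fderiv ℝ (evalPlane p) (γ y, y) (0, 1)) y := by
  have h1 : HasDerivAt (fun t => (γ t, t)) (γ', (1 : ℝ)) y := h.prodMk (hasDerivAt_id y)
  have h2 := HasFDerivAt.comp_hasDerivAt (f := fun t => (γ t, t)) y
    (differentiable_evalPlane p (γ y, y)).hasFDerivAt h1
  have h3 : ((γ', 1) : ℝ × ℝ) = γ' • ((1, 0) : ℝ × ℝ) + (0, 1) := by simp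
  rw [h3, map_add, map_smul, smul_eq_mul] at h2
  exact h2

theorem hasDerivAt_evalPlane_fst (p : MvPolynomial (Fin 2) ℝ) (x y : ℝ) :
    HasDerivAt (fun t => evalPlane p (t, y)) (fderiv ℝ (evalPlane p) (x, y) (1, 0)) x :=
  HasFDerivAt.comp_hasDerivAt (f := fun t => (t, y)) x
    (differentiable_evalPlane p (x, y)).hasFDerivAt ((hasDerivAt_id x).prodMk (hasDerivAt_const x y))

/-- If the Jacobian determinant of `(p, q)` is positive, `q` increases with `y` along any piece of
a level curve of `p` that is a graph `x = γ y` and on which `∂p/∂x > 0`. -/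
theorem evalPlane_lt_of_level_curve {p q : MvPolynomial (Fin 2) ℝ}
    (hq : ∀ x y : ℝ, 0 < jacobianDet p q (x, y)) {γ : ℝ → ℝ} {a b c : ℝ} (hab : a < b)
    (hγ : ∀ y ∈ Icc a b, DifferentiableAt ℝ γ y)
    (hc : ∀ y ∈ Icc a b, evalPlane p (γ y, y) = c)
    (hx : ∀ y ∈ Icc a b, 0 < fderiv ℝ (evalPlane p) (γ y, y) (1, 0)) :
    evalPlane q (γ a, a) < evalPlane q (γ b, b) := by
  have hmono : StrictMonoOn (fun t => evalPlane q (γ t, t)) (Icc a b) := by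
    refine strictMonoOn_of_deriv_pos (convex_Icc a b)
      (fun y hy => (hasDerivAt_evalPlane_graph q
        (hγ y hy).hasDerivAt).continuousAt.continuousWithinAt) fun y hy => ?_
    rw [interior_Icc] at hy
    have hy' := Ioo_subset_Icc_self hy
    have hdp := hasDerivAt_evalPlane_graph p (hγ y hy').hasDerivAt
    have hconst : (fun t => evalPlane p (γ t, t)) =ᶠ[𝓝 y] fun _ => c := by
      filter_upwards [Icc_mem_nhds hy.1 hy.2] with t ht using hc t ht
    have h0 := hdp.unique ((hasDerivAt_const y c).congr_of_eventuallyEq hconst)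
    rw [(hasDerivAt_evalPlane_graph q (hγ y hy').hasDerivAt).deriv]
    have hj := hq (γ y) y
    rw [jacobianDet_eq] at hj
    -- As `γ' p_x = -p_y` on the level curve, `p_x` times the derivative of `q` along it is the
    -- Jacobian determinant.
    refine pos_of_mul_pos_right (a := fderiv ℝ (evalPlane p) (γ y, y) (1, 0)) ?_ (hx y hy').le
    rw [eq_neg_of_add_eq_zero_right h0] at hj
    linarith
  exact hmono (left_mem_Icc.2 hab.le) (right_mem_Icc.2 hab.le) hab

/-- A decreasing `r` is at most `r(0)` on `x > 0`; a lower bound there would make it bounded at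
`+∞`, hence constant. -/
theorem Polynomial.not_bddBelow_of_derivative_neg (r : Polynomial ℝ)
    (hr : ∀ x, r.derivative.eval x < 0) (K : ℝ) : ¬ ∀ x > 0, K ≤ r.eval x := by
  intro hK
  have hanti : StrictAnti fun x => r.eval x :=
    strictAnti_of_deriv_neg fun x => by rw [r.deriv]; exact hr x
  have hdeg : r.degree ≤ 0 := by
    rw [← Polynomial.isBoundedUnder_abs_atTop_iff]
    refine ⟨max |K| |r.eval 0|, ?_⟩
    rw [eventually_map]
    filter_upwards [eventually_gt_atTop 0] with x hx
    exact abs_le_max_abs_abs (hK x hx) (hanti hx).le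
  have := hr 0
  rw [Polynomial.eq_C_of_degree_le_zero hdeg] at this
  simp at this

/-- The restriction of `q` to the line `y = 0`, as a polynomial in one variable. -/
noncomputable def restrictLine (q : MvPolynomial (Fin 2) ℝ) : Polynomial ℝ :=
  MvPolynomial.aeval ![Polynomial.X, 0] q

theorem eval_restrictLine (q : MvPolynomial (Fin 2) ℝ) (x : ℝ) :
    (restrictLine q).eval x = evalPlane q (x, 0) := by
  unfold restrictLine evalPlane
  induction q using MvPolynomial.induction_on with
  | C a => simp
  | add p q hp hq => simp only [map_add, Polynomial.eval_add, hp, hq]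
  | mul_X p i hp =>
    simp only [map_mul, Polynomial.eval_mul, hp]
    fin_cases i <;> simp

theorem derivative_restrictLine_neg {p q : MvPolynomial (Fin 2) ℝ}
    (hq : ∀ x y : ℝ, 0 < jacobianDet p q (x, y))
    (hp : ∀ x, evalPlane p (x, 0) = 0)
    (hpy : ∀ x, HasDerivAt (fun y => evalPlane p (x, y)) 1 0) (x : ℝ) :
    (restrictLine q).derivative.eval x < 0 := by
  have h1 : fderiv ℝ (evalPlane p) (x, 0) (1, 0) = 0 := by
    have h := hasDerivAt_evalPlane_fst p x 0
    simp only [hp] at h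
    exact h.unique (hasDerivAt_const x 0)
  have h2 : fderiv ℝ (evalPlane p) (x, 0) (0, 1) = 1 := by
    have h := hasDerivAt_evalPlane_graph p (hasDerivAt_const (0 : ℝ) x)
    rw [zero_mul, zero_add] at h
    exact h.unique (hpy x)
  have h3 : (restrictLine q).derivative.eval x = fderiv ℝ (evalPlane q) (x, 0) (1, 0) := by
    have h := hasDerivAt_evalPlane_fst q x 0
    simp only [← eval_restrictLine] at h
    exact ((restrictLine q).hasDerivAt x).unique h
  have hj := hq x 0
  rw [jacobianDet_eq, h1, h2, ← h3] at hj
  linarith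

theorem not_jacobianDet_pos_of_eq_case1 {p q : MvPolynomial (Fin 2) ℝ}
    (hp : ∀ x y, evalPlane p (x, y) = y + x * y ^ 2 + y ^ 4)
    (hq : ∀ x y : ℝ, 0 < jacobianDet p q (x, y)) : False := by
  have hpx : ∀ x y, fderiv ℝ (evalPlane p) (x, y) (1, 0) = y ^ 2 := fun x y => by
    have h := hasDerivAt_evalPlane_fst p x y
    simp only [hp] at h
    refine h.unique ?_
    simpa using (((hasDerivAt_id x).mul_const (y ^ 2)).const_add y).add_const (y ^ 4)
  have hneg := derivative_restrictLine_neg hq (fun x => by simp [hp]) fun x => by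
    simp only [hp]
    have h := ((hasDerivAt_id (0 : ℝ)).add (((hasDerivAt_id (0 : ℝ)).pow 2).const_mul x)).add
      ((hasDerivAt_id (0 : ℝ)).pow 4)
    refine h.congr_deriv ?_
    simp
  -- `(0, -1)` is the limit, as `s → 0⁻`, of the point where the level curve through `(x, s)` meets
  -- `y = -1`.
  refine (restrictLine q).not_bddBelow_of_derivative_neg hneg (evalPlane q (0, -1)) fun x _ => ?_
  rw [eval_restrictLine]
  have hlt : ∀ s ∈ Ioo (-1 : ℝ) 0,
      evalPlane q (s + x * s ^ 2 + s ^ 4, -1) < evalPlane q (x, s) := by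
    intro s hs
    have h := evalPlane_lt_of_level_curve hq
      (γ := fun y => (s + x * s ^ 2 + s ^ 4 - y - y ^ 4) / y ^ 2)
      (c := s + x * s ^ 2 + s ^ 4) hs.1 ?_ ?_ ?_
    · convert h using 3
      · norm_num
      · have := hs.2.ne
        field_simp
        ring
    · intro y hy
      have : y ≠ 0 := (hy.2.trans_lt hs.2).ne
      fun_prop (disch := positivity)
    · intro y hy
      have : y ≠ 0 := (hy.2.trans_lt hs.2).ne
      rw [hp]
      field_simp
      ring
    · intro y hy
      have : y ≠ 0 := (hy.2.trans_lt hs.2).ne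
      rw [hpx]
      positivity
  have hq' := continuous_evalPlane q
  have h1 : Tendsto (fun s : ℝ => evalPlane q (s + x * s ^ 2 + s ^ 4, -1)) (𝓝[<] 0)
      (𝓝 (evalPlane q (0, -1))) := by
    refine Tendsto.mono_left ?_ nhdsWithin_le_nhds
    exact Continuous.tendsto' (by fun_prop) _ _ (by simp)
  have h2 : Tendsto (fun s : ℝ => evalPlane q (x, s)) (𝓝[<] 0) (𝓝 (evalPlane q (x, 0))) := by
    refine Tendsto.mono_left ?_ nhdsWithin_le_nhds
    exact Continuous.tendsto' (by fun_prop) _ _ rfl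
  refine le_of_tendsto_of_tendsto h1 h2 ?_
  filter_upwards [Ioo_mem_nhdsLT (show (-1 : ℝ) < 0 by norm_num)] with s hs using (hlt s hs).le

theorem not_jacobianDet_pos_of_eq_case2 {p q : MvPolynomial (Fin 2) ℝ} (a : ℝ)
    (hp : ∀ x y, evalPlane p (x, y) = y + a * y ^ 2 + x * y ^ 3)
    (hq : ∀ x y : ℝ, 0 < jacobianDet p q (x, y)) : False := by
  have hpx : ∀ x y, fderiv ℝ (evalPlane p) (x, y) (1, 0) = y ^ 3 := fun x y => by
    have h := hasDerivAt_evalPlane_fst p x y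
    simp only [hp] at h
    refine h.unique ?_
    simpa using ((hasDerivAt_id x).mul_const (y ^ 3)).const_add (y + a * y ^ 2)
  have hneg := derivative_restrictLine_neg hq (fun x => by simp [hp]) fun x => by
    simp only [hp]
    have h := ((hasDerivAt_id (0 : ℝ)).add (((hasDerivAt_id (0 : ℝ)).pow 2).const_mul a)).add
      (((hasDerivAt_id (0 : ℝ)).pow 3).const_mul x)
    refine h.congr_deriv ?_
    simp
  -- Here `p_x = y ^ 3` is positive only for `y > 0`, so the curve runs up to `y = 1` and bounds
  -- `q(x, 0)` from above; `x ↦ -q(-x, 0)` turns this into a lower bound.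
  refine (-(restrictLine q).comp (-Polynomial.X)).not_bddBelow_of_derivative_neg (fun x => ?_)
    (-evalPlane q (-1 - a, 1)) fun z _ => ?_
  · simpa [Polynomial.derivative_comp] using hneg (-x)
  rw [Polynomial.eval_neg, Polynomial.eval_comp, eval_restrictLine, neg_le_neg_iff]
  generalize Polynomial.eval z (-Polynomial.X) = x
  have hlt : ∀ s ∈ Ioo (0 : ℝ) 1,
      evalPlane q (x, s) < evalPlane q (s + a * s ^ 2 + x * s ^ 3 - 1 - a, 1) := by
    intro s hs
    have h := evalPlane_lt_of_level_curve hq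
      (γ := fun y => (s + a * s ^ 2 + x * s ^ 3 - y - a * y ^ 2) / y ^ 3)
      (c := s + a * s ^ 2 + x * s ^ 3) hs.2 ?_ ?_ ?_
    · convert h using 3
      · have := hs.1.ne'
        field_simp
        ring
      · norm_num
    · intro y hy
      have : y ≠ 0 := (hs.1.trans_le hy.1).ne'
      fun_prop (disch := positivity)
    · intro y hy
      have : y ≠ 0 := (hs.1.trans_le hy.1).ne'
      rw [hp]
      field_simp
      ring
    · intro y hy
      have : 0 < y := hs.1.trans_le hy.1
      rw [hpx]
      positivity
  have hq' := continuous_evalPlane q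
  have h1 : Tendsto (fun s : ℝ => evalPlane q (s + a * s ^ 2 + x * s ^ 3 - 1 - a, 1)) (𝓝[>] 0)
      (𝓝 (evalPlane q (-1 - a, 1))) := by
    refine Tendsto.mono_left ?_ nhdsWithin_le_nhds
    exact Continuous.tendsto' (by fun_prop) _ _ (by simp)
  have h2 : Tendsto (fun s : ℝ => evalPlane q (x, s)) (𝓝[>] 0) (𝓝 (evalPlane q (x, 0))) := by
    refine Tendsto.mono_left ?_ nhdsWithin_le_nhds
    exact Continuous.tendsto' (by fun_prop) _ _ rfl
  refine le_of_tendsto_of_tendsto h2 h1 ?_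
  filter_upwards [Ioo_mem_nhdsGT (show (0 : ℝ) < 1 by norm_num)] with s hs using (hlt s hs).le

/-- Solving for `x` gives a square root. Monotonicity in `y` keeps the radicand positive on `[-1,
s]`, and the branch `x > 0` has `p_x > 0`. -/
theorem not_jacobianDet_pos_of_eq_add_sq_mul_sq {p q : MvPolynomial (Fin 2) ℝ} (a b : ℝ)
    (hmono : Monotone fun y : ℝ => y + a * y ^ 2 + b * y ^ 3)
    (hp : ∀ x y, evalPlane p (x, y) = y + a * y ^ 2 + b * y ^ 3 + x ^ 2 * y ^ 2)
    (hq : ∀ x y : ℝ, 0 < jacobianDet p q (x, y)) : False := by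
  have hpx : ∀ x y, fderiv ℝ (evalPlane p) (x, y) (1, 0) = 2 * x * y ^ 2 := fun x y => by
    have h := hasDerivAt_evalPlane_fst p x y
    simp only [hp] at h
    refine h.unique ?_
    simpa using (((hasDerivAt_id x).pow 2).mul_const (y ^ 2)).const_add
      (y + a * y ^ 2 + b * y ^ 3)
  have hneg := derivative_restrictLine_neg hq (fun x => by simp [hp]) fun x => by
    simp only [hp]
    have h := (((hasDerivAt_id (0 : ℝ)).add (((hasDerivAt_id (0 : ℝ)).pow 2).const_mul a)).add
      (((hasDerivAt_id (0 : ℝ)).pow 3).const_mul b)).add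
        (((hasDerivAt_id (0 : ℝ)).pow 2).const_mul (x ^ 2))
    refine h.congr_deriv ?_
    simp
  refine (restrictLine q).not_bddBelow_of_derivative_neg hneg
    (evalPlane q (√(1 - a + b), -1)) fun x hx => ?_
  rw [eval_restrictLine]
  have hlt : ∀ s ∈ Ioo (-1 : ℝ) 0,
      evalPlane q (√(s + a * s ^ 2 + b * s ^ 3 + x ^ 2 * s ^ 2 + 1 - a + b), -1) <
        evalPlane q (x, s) := by
    intro s hs
    have hpos : ∀ y ∈ Icc (-1) s, y ≠ 0 ∧
        0 < (s + a * s ^ 2 + b * s ^ 3 + x ^ 2 * s ^ 2 - y - a * y ^ 2 - b * y ^ 3) / y ^ 2 := by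
      intro y hy
      have hy0 : y ≠ 0 := (hy.2.trans_lt hs.2).ne
      have hs0 := hs.2.ne
      have h1 := hmono hy.2
      have h2 : 0 < x ^ 2 * s ^ 2 := by positivity
      refine ⟨hy0, div_pos ?_ (by positivity)⟩
      simp only at h1
      linarith
    have h := evalPlane_lt_of_level_curve hq
      (γ := fun y =>
        √((s + a * s ^ 2 + b * s ^ 3 + x ^ 2 * s ^ 2 - y - a * y ^ 2 - b * y ^ 3) / y ^ 2))
      (c := s + a * s ^ 2 + b * s ^ 3 + x ^ 2 * s ^ 2) hs.1 ?_ ?_ ?_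
    · convert h using 3
      · congr 1
        ring
      · rw [eq_comm, Real.sqrt_eq_iff_mul_self_eq_of_pos hx]
        have := hs.2.ne
        field_simp
        ring
    · intro y hy
      obtain ⟨hy0, hy1⟩ := hpos y hy
      refine DifferentiableAt.sqrt ?_ hy1.ne'
      fun_prop (disch := positivity)
    · intro y hy
      obtain ⟨hy0, hy1⟩ := hpos y hy
      rw [hp, Real.sq_sqrt hy1.le]
      field_simp
      ring
    · intro y hy
      obtain ⟨hy0, hy1⟩ := hpos y hy
      rw [hpx]
      have := Real.sqrt_pos.2 hy1
      positivity
  have hq' := continuous_evalPlane q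
  have h1 : Tendsto (fun s : ℝ => evalPlane q
      (√(s + a * s ^ 2 + b * s ^ 3 + x ^ 2 * s ^ 2 + 1 - a + b), -1)) (𝓝[<] 0)
      (𝓝 (evalPlane q (√(1 - a + b), -1))) := by
    refine Tendsto.mono_left ?_ nhdsWithin_le_nhds
    exact Continuous.tendsto' (by fun_prop) _ _ (by simp)
  have h2 : Tendsto (fun s : ℝ => evalPlane q (x, s)) (𝓝[<] 0) (𝓝 (evalPlane q (x, 0))) := by
    refine Tendsto.mono_left ?_ nhdsWithin_le_nhds
    exact Continuous.tendsto' (by fun_prop) _ _ rfl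
  refine le_of_tendsto_of_tendsto h1 h2 ?_
  filter_upwards [Ioo_mem_nhdsLT (show (-1 : ℝ) < 0 by norm_num)] with s hs using (hlt s hs).le

theorem monotone_cubic_of_sq_lt {a : ℝ} (ha : a ^ 2 - 3 < 0) :
    Monotone fun y : ℝ => y + a * y ^ 2 + 1 * y ^ 3 := by
  intro y z hyz
  have h : 0 ≤ (z - y) * (1 + a * (z + y) + (z ^ 2 + z * y + y ^ 2)) := by
    refine mul_nonneg (sub_nonneg.2 hyz) ?_
    -- The factor equals `(z - y)² / 4 + (3(z + y) + 2a)² / 12 + (3 - a²) / 3`.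
    nlinarith [sq_nonneg (z - y), sq_nonneg (3 * (z + y) + 2 * a)]
  simp only
  linarith

theorem theorem5p4 (p : MvPolynomial (Fin 2) ℝ) (hp : IsQuarticNormalForm p) :
    ¬ ∃ q : MvPolynomial (Fin 2) ℝ, ∀ x y : ℝ, 0 < jacobianDet p q (x, y) := by
  rintro ⟨q, hq⟩
  cases hp with
  | case1 => exact not_jacobianDet_pos_of_eq_case1 (fun x y => by simp [evalPlane]) hq
  | case2 a _ => exact not_jacobianDet_pos_of_eq_case2 a (fun x y => by simp [evalPlane]) hq
  | case3 =>
    refine not_jacobianDet_pos_of_eq_add_sq_mul_sq 0 0 ?_ (fun x y => by simp [evalPlane]) hq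
    intro y z hyz
    simpa using hyz
  | case4 a ha =>
    exact not_jacobianDet_pos_of_eq_add_sq_mul_sq a 1 (monotone_cubic_of_sq_lt ha)
      (fun x y => by simp [evalPlane]) hq
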